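/- All partial latin squares (PLS) are finite. A PLS is a finite set $P\subseteq R\times C\times S$ of triples (row, column, symbol), where $R$, $C$, $S$ are pairwise disjoint, such that any two coordinates of a triple of $P$ determine the third. A \emph{latin bitrade} is a pair $(W,B)$ of non-empty PLS such that for each $(r,c,s)\in W$ (respectively $B$) there exist unique $r'\ne r$, $c'\ne c$, $s'\ne s$ with $(r',c,s)$, $(r,c',s)$ and $(r,c,s')$ in $B$ (respectively $W$). It is \emph{connected} if there are no latin bitrades $(W_1,B_1)$ and $(W_2,B_2)$ with $W_1\cap W_2=\emptyset$, $W=W_1\cup W_2$ and $B=B_1\cup B_2$. A row $r$ is \emph{separated} if the permutation $\psi_r$ of the symbols in row $r$, defined by $\psi_r(s)=s'$ if and only if $(r,c,s)\in W$ and $(r,c,s')\in B$ for some $c$, is a single cycle; separated columns and symbols are defined in the same way, and the bitrade is \emph{separated} if every row, column and symbol occurring in it is separated. The triangulation associated with a connected separated latin bitrade $(W,B)$ has as vertices the rows, columns and symbols that occur, as edges the pairs of vertices occurring together in a triple of $W$, and as faces the triples of $W$ and of $B$; with $v$ vertices, $e$ edges and $f=|W|+|B|$ faces, the genus of $(W,B)$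 is $\tfrac12(2-f+e-v)$. A \emph{planar} (or \emph{spherical}) latin bitrade is a connected separated latin bitrade of genus $0$, and a \emph{spherical latin trade} is a $W$ for which some $(W,B)$ is a planar latin bitrade. Let $(W,B)$ be a planar latin bitrade. If $(W,B')$ is a latin bitrade and $B'\neq B$, then $(W,B')$ is not connected and is not separated. Consequently, for each spherical latin trade $W$ there is exactly one $B$ such that $(W,B)$ is a connected and separated latin bitrade. -/

import Mathlib

/-!
Latin bitrades.  Rows, columns and symbols are elements of three types `R`, `C`, `S`, so the three
kinds of labels are automatically disjoint.  A filled cell is a triple `(r, c, s)`.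
-/

namespace LatinBitrade

variable {R C S : Type*}

/-- A (finite) partial latin square, as its set of filled cells: each cell holds at most one symbol,
each symbol occurs at most once in each row and at most once in each column. -/
structure IsPLS (P : Finset (R × C × S)) : Prop where
  cell : ∀ r c s s', (r, c, s) ∈ P → (r, c, s') ∈ P → s = s'
  row : ∀ r c c' s, (r, c, s) ∈ P → (r, c', s) ∈ P → c = c'
  col : ∀ r r' c s, (r, c, s) ∈ P → (r', c, s) ∈ P → r = r'

/-- For each `(r, c, s) ∈ P` there are unique `r' ≠ r`, `c' ≠ c`, `s' ≠ s` such that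
`(r', c, s)`, `(r, c', s)` and `(r, c, s')` lie in `Q`. -/
def HasPartners (P Q : Finset (R × C × S)) : Prop :=
  ∀ r c s, (r, c, s) ∈ P →
    (∃! r', r' ≠ r ∧ (r', c, s) ∈ Q) ∧
    (∃! c', c' ≠ c ∧ (r, c', s) ∈ Q) ∧
    (∃! s', s' ≠ s ∧ (r, c, s') ∈ Q)

/-- `(W, B)` is a latin bitrade. -/
structure IsBitrade (W B : Finset (R × C × S)) : Prop where
  left_nonempty : W.Nonempty
  right_nonempty : B.Nonempty
  left_pls : IsPLS W
  right_pls : IsPLS B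
  left_partners : HasPartners W B
  right_partners : HasPartners B W

/-- The bitrade `(W, B)` is connected: it is not the union of two latin bitrades `(W₁, B₁)` and
`(W₂, B₂)` with `W₁` and `W₂` disjoint. -/
def IsConnected [DecidableEq R] [DecidableEq C] [DecidableEq S]
    (W B : Finset (R × C × S)) : Prop :=
  ¬ ∃ W₁ B₁ W₂ B₂ : Finset (R × C × S),
    IsBitrade W₁ B₁ ∧ IsBitrade W₂ B₂ ∧ W₁ ∩ W₂ = ∅ ∧ W = W₁ ∪ W₂ ∧ B = B₁ ∪ B₂

/-- The relation `step` on the set `T` is the graph of a permutation of `T`, and this permutation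
consists of a single cycle through all elements of `T`. -/
def IsSingleCycle {α : Type*} (T : Set α) (step : α → α → Prop) : Prop :=
  ∃ ψ : Equiv.Perm T, (∀ x y : T, ψ x = y ↔ step x y) ∧ ψ.IsCycleOn Set.univ

/-- Row `r` is separated: the permutation `ψ_r` of the symbols in row `r`, where `ψ_r s = s'` iff
`(r, c, s) ∈ W` and `(r, c, s') ∈ B` for some `c`, is a single cycle. -/
def RowSeparated (W B : Finset (R × C × S)) (r : R) : Prop :=
  IsSingleCycle {s : S | ∃ c, (r, c, s) ∈ W} fun s s' => ∃ c, (r, c, s) ∈ W ∧ (r, c, s') ∈ B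

/-- Column `c` is separated: the permutation of the symbols in column `c`, mapping `s` to `s'` iff
`(r, c, s) ∈ W` and `(r, c, s') ∈ B` for some `r`, is a single cycle. -/
def ColSeparated (W B : Finset (R × C × S)) (c : C) : Prop :=
  IsSingleCycle {s : S | ∃ r, (r, c, s) ∈ W} fun s s' => ∃ r, (r, c, s) ∈ W ∧ (r, c, s') ∈ B

/-- Symbol `s` is separated: the permutation of the rows containing `s`, mapping `r` to `r'` iff
`(r, c, s) ∈ W` and `(r', c, s) ∈ B` for some `c`, is a single cycle. -/
def SymSeparated (W B : Finset (R × C × S)) (s : S) : Prop :=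
  IsSingleCycle {r : R | ∃ c, (r, c, s) ∈ W} fun r r' => ∃ c, (r, c, s) ∈ W ∧ (r', c, s) ∈ B

/-- The bitrade `(W, B)` is separated: every row, column and symbol occurring in it is separated. -/
def IsSeparated (W B : Finset (R × C × S)) : Prop :=
  ∀ r c s, (r, c, s) ∈ W → RowSeparated W B r ∧ ColSeparated W B c ∧ SymSeparated W B s

section Genus

variable [DecidableEq R] [DecidableEq C] [DecidableEq S]

/-- The vertices of the triangulation of a bitrade with first component `W`:
the rows, columns and symbols that are used. -/
def vertices (W : Finset (R × C × S)) : Finset (R ⊕ C ⊕ S) :=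
  W.biUnion fun t => {Sum.inl t.1, Sum.inr (Sum.inl t.2.1), Sum.inr (Sum.inr t.2.2)}

/-- The edges of the triangulation: the pairs of vertices that occur within some triple of `W`. -/
def edges (W : Finset (R × C × S)) : Finset (Sym2 (R ⊕ C ⊕ S)) :=
  W.biUnion fun t =>
    {s(Sum.inl t.1, Sum.inr (Sum.inl t.2.1)),
     s(Sum.inr (Sum.inl t.2.1), Sum.inr (Sum.inr t.2.2)),
     s(Sum.inr (Sum.inr t.2.2), Sum.inl t.1)}

/-- The genus `(2 - f + e - v) / 2` of the triangulation of a connected separated bitrade `(W, B)`,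
whose faces are the white triangles (the triples of `W`) and the black ones (the triples of `B`). -/
def genus (W B : Finset (R × C × S)) : ℚ :=
  (2 - ((W.card : ℚ) + (B.card : ℚ)) + ((edges W).card : ℚ) - ((vertices W).card : ℚ)) / 2

/-- `(W, B)` is a planar (spherical) latin bitrade: connected, separated and of genus `0`. -/
structure IsPlanar (W B : Finset (R × C × S)) : Prop where
  bitrade : IsBitrade W B
  connected : IsConnected W B
  separated : IsSeparated W B
  genus_eq_zero : genus W B = 0

/-- `W` is a spherical latin trade: some disjoint mate makes it a planar latin bitrade. -/
def IsSphericalTrade (W : Finset (R × C × S)) : Prop :=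
  ∃ B, IsPlanar W B

end Genus

end LatinBitrade

/-! Genus zero enters as vanishing rational first homology: every closed edge cycle of the
triangulation of `(W, B)` bounds a combination of faces. Suppose `B'` is another mate of `W` and
pick `T = (r₀, c₀, s₀)` in `B'` but not in `B`. The three edges of `T` are edges of the
triangulation, so this closed triangle is the boundary of a face function `(x, y)`: crossing from
white to black, the value drops by 1 at the edges of `T` and is unchanged at all others
(`IsPlanar.exists_potential`).

Since `(W, B)` is separated, `x` is constant on the white faces around each vertex off `T`. A triple
of `B'` other than `T` shares at most one vertex with `T`, so its three white neighbours take the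
same value. A summation over `W` forces the same at `T`. Hence `x` descends to a function agreeing
across every edge of `(W, B')` (`IsPlanar.exists_agreeOnEdges`). It is not constant around `r₀`,
because `T` is not a face of `(W, B)`. Such a function would be constant if `(W, B')` were
connected, and constant around `r₀` if `(W, B')` were separated.

Homology is handled by linear algebra: jumps of face functions are orthogonal to coboundaries of
vertex functions, and Euler's formula makes the two together span all edge functions. -/

namespace LatinBitrade

/-! ### Reindexing along edges and invariance along a cycle -/

section Transfer

/-- Two finite sets on which `π` is injective with the same image are matched by a map preserving
`π`, along which sums can be reindexed. -/
theorem exists_transfer {α κ : Type*} {P Q : Finset α} {π : α → κ}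
    (hP : ∀ p ∈ P, ∀ p' ∈ P, π p = π p' → p = p') (hQ : ∀ q ∈ Q, ∀ q' ∈ Q, π q = π q' → q = q')
    (hPQ : ∀ p ∈ P, ∃ q ∈ Q, π q = π p) (hQP : ∀ q ∈ Q, ∃ p ∈ P, π p = π q) :
    ∃ β : α → α, (∀ p ∈ P, β p ∈ Q ∧ π (β p) = π p) ∧
      ∀ F : α → ℚ, ∑ p ∈ P, F (β p) = ∑ q ∈ Q, F q := by
  have h : ∀ p, ∃ q, p ∈ P → q ∈ Q ∧ π q = π p := by
    intro p
    by_cases hp : p ∈ P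
    · obtain ⟨q, hq⟩ := hPQ p hp
      exact ⟨q, fun _ => hq⟩
    · exact ⟨p, fun h => absurd h hp⟩
  choose β hβ using h
  refine ⟨β, hβ, fun F => ?_⟩
  refine Finset.sum_bij (fun p _ => β p) (fun p hp => (hβ p hp).1) ?_ ?_ (fun _ _ => rfl)
  · intro p hp p' hp' h
    exact hP p hp p' hp' (by rw [← (hβ p hp).2, ← (hβ p' hp').2, h])
  · intro q hq
    obtain ⟨p, hp, hpq⟩ := hQP q hq
    exact ⟨p, hp, hQ _ (hβ p hp).1 q hq (by rw [(hβ p hp).2, hpq])⟩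

/-- A single cycle admits no proper invariant subset. -/
theorem IsSingleCycle.forall_of_invariant {α : Type*} {T : Set α} {step : α → α → Prop}
    (h : IsSingleCycle T step) {p : α → Prop} (hp : ∀ a b, step a b → (p a ↔ p b))
    {a b : α} (ha : a ∈ T) (hb : b ∈ T) (hpa : p a) : p b := by
  obtain ⟨ψ, hψ, hcyc⟩ := h
  have hstep : ∀ x : T, p x ↔ p (ψ x) := fun x => hp _ _ ((hψ x (ψ x)).1 rfl)
  have hpow : ∀ (n : ℕ) (x : T), p x ↔ p ((ψ ^ n) x) := by
    intro n
    induction n with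
    | zero => simp
    | succ k ih => intro x; rw [pow_succ, Equiv.Perm.mul_apply, ← ih, ← hstep]
  obtain ⟨k, hk⟩ := hcyc.2 (Set.mem_univ (⟨a, ha⟩ : T)) (Set.mem_univ (⟨b, hb⟩ : T))
  obtain ⟨n, rfl | rfl⟩ := k.eq_nat_or_neg
  · have := (hpow n ⟨a, ha⟩).1 hpa
    rw [zpow_natCast] at hk
    rwa [hk] at this
  · rw [zpow_neg, zpow_natCast, Equiv.Perm.inv_eq_iff_eq] at hk
    have := (hpow n ⟨b, hb⟩).2
    rw [← hk] at this
    exact this hpa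

end Transfer

/-! ### Bitrades: symmetry and faces across an edge -/

variable {R C S : Type*} {W B : Finset (R × C × S)}

theorem IsPLS.mono {P Q : Finset (R × C × S)} (h : IsPLS Q) (hPQ : P ⊆ Q) :
    IsPLS P :=
  ⟨fun r c s s' h1 h2 => h.cell r c s s' (hPQ h1) (hPQ h2),
    fun r c c' s h1 h2 => h.row r c c' s (hPQ h1) (hPQ h2),
    fun r r' c s h1 h2 => h.col r r' c s (hPQ h1) (hPQ h2)⟩

theorem IsBitrade.symm (h : IsBitrade W B) : IsBitrade B W :=
  ⟨h.right_nonempty, h.left_nonempty, h.right_pls, h.left_pls, h.right_partners, h.left_partners⟩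

theorem IsBitrade.exists_row_col (h : IsBitrade W B) {r : R} {c : C} {s : S} (hw : (r, c, s) ∈ W) :
    ∃ s', (r, c, s') ∈ B :=
  (h.left_partners r c s hw).2.2.exists.imp fun _ h => h.2

theorem IsBitrade.exists_col_sym (h : IsBitrade W B) {r : R} {c : C} {s : S} (hw : (r, c, s) ∈ W) :
    ∃ r', (r', c, s) ∈ B :=
  (h.left_partners r c s hw).1.exists.imp fun _ h => h.2

theorem IsBitrade.exists_row_sym (h : IsBitrade W B) {r : R} {c : C} {s : S} (hw : (r, c, s) ∈ W) :
    ∃ c', (r, c', s) ∈ B :=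
  (h.left_partners r c s hw).2.1.exists.imp fun _ h => h.2

theorem IsBitrade.exists_transfer_row_col (h : IsBitrade W B) :
    ∃ β : R × C × S → R × C × S,
      (∀ t ∈ W, β t ∈ B ∧ ((β t).1, (β t).2.1) = (t.1, t.2.1)) ∧
      ∀ F : R × C × S → ℚ, ∑ t ∈ W, F (β t) = ∑ t ∈ B, F t := by
  refine exists_transfer (π := fun t : R × C × S => (t.1, t.2.1)) ?_ ?_ ?_ ?_
  · rintro ⟨r, c, s⟩ hp ⟨r', c', s'⟩ hp' he
    obtain ⟨rfl, rfl⟩ := Prod.mk.inj he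
    rw [h.left_pls.cell _ _ _ _ hp hp']
  · rintro ⟨r, c, s⟩ hp ⟨r', c', s'⟩ hp' he
    obtain ⟨rfl, rfl⟩ := Prod.mk.inj he
    rw [h.right_pls.cell _ _ _ _ hp hp']
  · rintro ⟨r, c, s⟩ hp
    obtain ⟨s', hs⟩ := h.exists_row_col hp
    exact ⟨_, hs, rfl⟩
  · rintro ⟨r, c, s⟩ hp
    obtain ⟨s', hs⟩ := h.symm.exists_row_col hp
    exact ⟨_, hs, rfl⟩

theorem IsBitrade.exists_transfer_col_sym (h : IsBitrade W B) :
    ∃ β : R × C × S → R × C × S, (∀ t ∈ W, β t ∈ B ∧ (β t).2 = t.2) ∧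
      ∀ F : R × C × S → ℚ, ∑ t ∈ W, F (β t) = ∑ t ∈ B, F t := by
  refine exists_transfer (π := fun t : R × C × S => t.2) ?_ ?_ ?_ ?_
  · rintro ⟨r, c, s⟩ hp ⟨r', c', s'⟩ hp' he
    obtain ⟨rfl, rfl⟩ := Prod.mk.inj he
    rw [h.left_pls.col _ _ _ _ hp hp']
  · rintro ⟨r, c, s⟩ hp ⟨r', c', s'⟩ hp' he
    obtain ⟨rfl, rfl⟩ := Prod.mk.inj he
    rw [h.right_pls.col _ _ _ _ hp hp']
  · rintro ⟨r, c, s⟩ hp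
    obtain ⟨s', hs⟩ := h.exists_col_sym hp
    exact ⟨_, hs, rfl⟩
  · rintro ⟨r, c, s⟩ hp
    obtain ⟨s', hs⟩ := h.symm.exists_col_sym hp
    exact ⟨_, hs, rfl⟩

theorem IsBitrade.exists_transfer_row_sym (h : IsBitrade W B) :
    ∃ β : R × C × S → R × C × S,
      (∀ t ∈ W, β t ∈ B ∧ ((β t).1, (β t).2.2) = (t.1, t.2.2)) ∧
      ∀ F : R × C × S → ℚ, ∑ t ∈ W, F (β t) = ∑ t ∈ B, F t := by
  refine exists_transfer (π := fun t : R × C × S => (t.1, t.2.2)) ?_ ?_ ?_ ?_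
  · rintro ⟨r, c, s⟩ hp ⟨r', c', s'⟩ hp' he
    obtain ⟨rfl, rfl⟩ := Prod.mk.inj he
    rw [h.left_pls.row _ _ _ _ hp hp']
  · rintro ⟨r, c, s⟩ hp ⟨r', c', s'⟩ hp' he
    obtain ⟨rfl, rfl⟩ := Prod.mk.inj he
    rw [h.right_pls.row _ _ _ _ hp hp']
  · rintro ⟨r, c, s⟩ hp
    obtain ⟨s', hs⟩ := h.exists_row_sym hp
    exact ⟨_, hs, rfl⟩
  · rintro ⟨r, c, s⟩ hp
    obtain ⟨s', hs⟩ := h.symm.exists_row_sym hp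
    exact ⟨_, hs, rfl⟩

theorem IsBitrade.card_eq (h : IsBitrade W B) : W.card = B.card := by
  obtain ⟨β, -, hsum⟩ := h.exists_transfer_row_col
  have := hsum fun _ => 1
  simp only [Finset.sum_const, nsmul_eq_mul, mul_one] at this
  exact_mod_cast this

/-! ### Functions agreeing across edges, and connectedness -/

/-- The functions `x` on white faces and `y` on black faces agree across every edge of the
triangulation. -/
structure AgreeOnEdges (W B : Finset (R × C × S)) (x y : R × C × S → ℚ) : Prop where
  row_col : ∀ r c s s', (r, c, s) ∈ W → (r, c, s') ∈ B → x (r, c, s) = y (r, c, s')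
  col_sym : ∀ r r' c s, (r, c, s) ∈ W → (r', c, s) ∈ B → x (r, c, s) = y (r', c, s)
  row_sym : ∀ r c c' s, (r, c, s) ∈ W → (r, c', s) ∈ B → x (r, c, s) = y (r, c', s)

namespace AgreeOnEdges

variable {x y : R × C × S → ℚ}

theorem symm (h : AgreeOnEdges W B x y) : AgreeOnEdges B W y x :=
  ⟨fun r c s s' hb hw => (h.row_col r c s' s hw hb).symm,
    fun r r' c s hb hw => (h.col_sym r' r c s hw hb).symm,
    fun r c c' s hb hw => (h.row_sym r c' c s hw hb).symm⟩

-- Partners are the faces across the edges, so a face and its partners have equal value and a level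
-- set is closed under taking partners.
open Classical in
theorem hasPartners_filter (h : AgreeOnEdges W B x y) (hp : HasPartners W B) (p : ℚ → Prop) :
    HasPartners (W.filter fun t => p (x t)) (B.filter fun t => p (y t)) := by
  intro r c s ht
  obtain ⟨hw, hpx⟩ := Finset.mem_filter.1 ht
  obtain ⟨h1, h2, h3⟩ := hp r c s hw
  refine ⟨(existsUnique_congr fun r' => ?_).2 h1, (existsUnique_congr fun c' => ?_).2 h2,
    (existsUnique_congr fun s' => ?_).2 h3⟩
  · simp only [Finset.mem_filter]
    exact ⟨fun h' => ⟨h'.1, h'.2.1⟩, fun h' => ⟨h'.1, h'.2, h.col_sym _ _ _ _ hw h'.2 ▸ hpx⟩⟩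
  · simp only [Finset.mem_filter]
    exact ⟨fun h' => ⟨h'.1, h'.2.1⟩, fun h' => ⟨h'.1, h'.2, h.row_sym _ _ _ _ hw h'.2 ▸ hpx⟩⟩
  · simp only [Finset.mem_filter]
    exact ⟨fun h' => ⟨h'.1, h'.2.1⟩, fun h' => ⟨h'.1, h'.2, h.row_col _ _ _ _ hw h'.2 ▸ hpx⟩⟩

open Classical in
theorem isBitrade_filter (h : AgreeOnEdges W B x y) (hWB : IsBitrade W B) {p : ℚ → Prop}
    {t : R × C × S} (ht : t ∈ W) (hpt : p (x t)) :
    IsBitrade (W.filter fun t => p (x t)) (B.filter fun t => p (y t)) := by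
  have hW := h.hasPartners_filter hWB.left_partners p
  have ht' : t ∈ W.filter fun t => p (x t) := Finset.mem_filter.2 ⟨ht, hpt⟩
  obtain ⟨r, hr⟩ := (hW t.1 t.2.1 t.2.2 ht').1.exists
  exact ⟨⟨t, ht'⟩, ⟨_, hr.2⟩, hWB.left_pls.mono (Finset.filter_subset _ _),
    hWB.right_pls.mono (Finset.filter_subset _ _), hW,
    h.symm.hasPartners_filter hWB.right_partners p⟩

theorem eq_of_isConnected [DecidableEq R] [DecidableEq C] [DecidableEq S]
    (h : AgreeOnEdges W B x y) (hWB : IsBitrade W B) (hconn : IsConnected W B)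
    {t t' : R × C × S} (ht : t ∈ W) (ht' : t' ∈ W) : x t = x t' := by
  classical
  by_contra hne
  -- The level set of `x t` and its complement are both non-empty, and would split the bitrade.
  refine hconn ⟨_, _, _, _, h.isBitrade_filter hWB (p := fun q => q = x t) ht rfl,
    h.isBitrade_filter hWB (p := fun q => ¬ q = x t) ht' (Ne.symm hne), ?_, ?_, ?_⟩
  · ext u
    simp only [Finset.mem_inter, Finset.mem_filter, Finset.notMem_empty, iff_false]
    tauto
  · ext u
    simp only [Finset.mem_union, Finset.mem_filter]
    tauto
  · ext u
    simp only [Finset.mem_union, Finset.mem_filter]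
    tauto

end AgreeOnEdges

/-! ### Constancy around a separated vertex -/

section Around

variable {x y : R × C × S → ℚ}

/-- A function that agrees across the edges at a separated row is constant around it. -/
theorem eq_of_rowSeparated (hW : IsPLS W) {r : R} (hr : RowSeparated W B r)
    (h1 : ∀ c s s', (r, c, s) ∈ W → (r, c, s') ∈ B → x (r, c, s) = y (r, c, s'))
    (h2 : ∀ c c' s, (r, c, s) ∈ W → (r, c', s) ∈ B → x (r, c, s) = y (r, c', s))
    (hB : ∀ c s, (r, c, s) ∈ B → ∃ c', (r, c', s) ∈ W)
    {c c' : C} {s s' : S} (ht : (r, c, s) ∈ W) (ht' : (r, c', s') ∈ W) :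
    x (r, c, s) = x (r, c', s') := by
  -- The invariant set: symbols whose white face in row `r` has the starting value. One step of the
  -- cycle crosses two edges at `r`, into a black face and out into the next white one.
  have := hr.forall_of_invariant (p := fun a => ∃ d, (r, d, a) ∈ W ∧ x (r, d, a) = x (r, c, s))
    ?_ (a := s) (b := s') ⟨c, ht⟩ ⟨c', ht'⟩ ⟨c, ht, rfl⟩
  · obtain ⟨d, hd, hx⟩ := this
    rw [hW.row _ _ _ _ ht' hd, hx]
  · rintro a b ⟨d, hda, hdb⟩
    obtain ⟨e, he⟩ := hB _ _ hdb
    have hx : x (r, d, a) = x (r, e, b) := (h1 _ _ _ hda hdb).trans (h2 _ _ _ he hdb).symm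
    constructor
    · rintro ⟨d', hd', hx'⟩
      obtain rfl := hW.row _ _ _ _ hda hd'
      exact ⟨e, he, hx ▸ hx'⟩
    · rintro ⟨e', he', hx'⟩
      obtain rfl := hW.row _ _ _ _ he he'
      exact ⟨d, hda, hx ▸ hx'⟩

/-- A function that agrees across the edges at a separated column is constant around it. -/
theorem eq_of_colSeparated (hW : IsPLS W) {c : C} (hc : ColSeparated W B c)
    (h1 : ∀ r s s', (r, c, s) ∈ W → (r, c, s') ∈ B → x (r, c, s) = y (r, c, s'))
    (h2 : ∀ r r' s, (r, c, s) ∈ W → (r', c, s) ∈ B → x (r, c, s) = y (r', c, s))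
    (hB : ∀ r s, (r, c, s) ∈ B → ∃ r', (r', c, s) ∈ W)
    {r r' : R} {s s' : S} (ht : (r, c, s) ∈ W) (ht' : (r', c, s') ∈ W) :
    x (r, c, s) = x (r', c, s') := by
  have := hc.forall_of_invariant (p := fun a => ∃ d, (d, c, a) ∈ W ∧ x (d, c, a) = x (r, c, s))
    ?_ (a := s) (b := s') ⟨r, ht⟩ ⟨r', ht'⟩ ⟨r, ht, rfl⟩
  · obtain ⟨d, hd, hx⟩ := this
    rw [hW.col _ _ _ _ ht' hd, hx]
  · rintro a b ⟨d, hda, hdb⟩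
    obtain ⟨e, he⟩ := hB _ _ hdb
    have hx : x (d, c, a) = x (e, c, b) := (h1 _ _ _ hda hdb).trans (h2 _ _ _ he hdb).symm
    constructor
    · rintro ⟨d', hd', hx'⟩
      obtain rfl := hW.col _ _ _ _ hda hd'
      exact ⟨e, he, hx ▸ hx'⟩
    · rintro ⟨e', he', hx'⟩
      obtain rfl := hW.col _ _ _ _ he he'
      exact ⟨d, hda, hx ▸ hx'⟩

/-- A function that agrees across the edges at a separated symbol is constant around it. -/
theorem eq_of_symSeparated (hW : IsPLS W) {s : S} (hs : SymSeparated W B s)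
    (h1 : ∀ r r' c, (r, c, s) ∈ W → (r', c, s) ∈ B → x (r, c, s) = y (r', c, s))
    (h2 : ∀ r c c', (r, c, s) ∈ W → (r, c', s) ∈ B → x (r, c, s) = y (r, c', s))
    (hB : ∀ r c, (r, c, s) ∈ B → ∃ c', (r, c', s) ∈ W)
    {r r' : R} {c c' : C} (ht : (r, c, s) ∈ W) (ht' : (r', c', s) ∈ W) :
    x (r, c, s) = x (r', c', s) := by
  have := hs.forall_of_invariant (p := fun a => ∃ d, (a, d, s) ∈ W ∧ x (a, d, s) = x (r, c, s))
    ?_ (a := r) (b := r') ⟨c, ht⟩ ⟨c', ht'⟩ ⟨c, ht, rfl⟩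
  · obtain ⟨d, hd, hx⟩ := this
    rw [hW.row _ _ _ _ ht' hd, hx]
  · rintro a b ⟨d, hda, hdb⟩
    obtain ⟨e, he⟩ := hB _ _ hdb
    have hx : x (a, d, s) = x (b, e, s) := (h1 _ _ _ hda hdb).trans (h2 _ _ _ he hdb).symm
    constructor
    · rintro ⟨d', hd', hx'⟩
      obtain rfl := hW.row _ _ _ _ hda hd'
      exact ⟨e, he, hx ▸ hx'⟩
    · rintro ⟨e', he', hx'⟩
      obtain rfl := hW.row _ _ _ _ he he'
      exact ⟨d, hda, hx ▸ hx'⟩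

end Around

/-! ### Euler's formula -/

section Counting

variable [DecidableEq R] [DecidableEq C] [DecidableEq S]

/-- Two coordinates determine the third, so distinct white faces share no edge. Edge functions can
therefore be indexed by a white face and one of its three sides. -/
theorem IsPLS.card_edges (h : IsPLS W) : (edges W).card = 3 * W.card := by
  rw [edges, Finset.card_biUnion]
  · rw [Finset.sum_const_nat (m := 3), mul_comm]
    rintro ⟨r, c, s⟩ -
    rw [Finset.card_eq_three]
    exact ⟨_, _, _, by simp, by simp, by simp, rfl⟩
  · rintro ⟨r, c, s⟩ ht ⟨r', c', s'⟩ ht' hne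
    refine Finset.disjoint_left.2 fun e he he' => ?_
    apply hne
    simp only [Finset.mem_insert, Finset.mem_singleton] at he he'
    rcases he with rfl | rfl | rfl
    · simp at he'
      obtain ⟨rfl, rfl⟩ := he'
      rw [h.cell _ _ _ _ ht ht']
    · simp at he'
      obtain ⟨rfl, rfl⟩ := he'
      rw [h.col _ _ _ _ ht ht']
    · simp at he'
      obtain ⟨rfl, rfl⟩ := he'
      rw [h.row _ _ _ _ ht ht']

/-- Genus zero with `e = 3|W|` and `f = 2|W|`. -/
theorem IsPlanar.card_vertices (h : IsPlanar W B) : (vertices W).card = W.card + 2 := by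
  have hg := h.genus_eq_zero
  rw [genus, ← h.bitrade.card_eq, h.bitrade.left_pls.card_edges] at hg
  push_cast at hg
  have : ((vertices W).card : ℚ) = W.card + 2 := by linarith
  exact_mod_cast this

/-- Extension by zero of a function on a finite set, as a linear map. -/
def extendZero {α : Type*} [DecidableEq α] (P : Finset α) : (P → ℚ) →ₗ[ℚ] (α → ℚ) where
  toFun f a := if h : a ∈ P then f ⟨a, h⟩ else 0
  map_add' f g := by
    ext a
    by_cases h : a ∈ P <;> simp [h]
  map_smul' q f := by
    ext a
    by_cases h : a ∈ P <;> simp [h]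

theorem extendZero_apply {α : Type*} [DecidableEq α] {P : Finset α} (f : P → ℚ) (a : P) :
    extendZero P f a = f a := by
  simp [extendZero]

end Counting

/-! ### Jumps and coboundaries -/

section Homology

/-- The coboundary of the vertex function `g` on the three edges of the face `t`. -/
def coboundary (g : R ⊕ C ⊕ S → ℚ) (t : R × C × S) : ℚ × ℚ × ℚ :=
  (g (.inr (.inl t.2.1)) - g (.inl t.1),
   g (.inr (.inr t.2.2)) - g (.inr (.inl t.2.1)),
   g (.inl t.1) - g (.inr (.inr t.2.2)))

/-- The jump of the face function `(x, y)` across the three edges of the white face `t`, where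
`β₁ t`, `β₂ t`, `β₃ t` are the black faces on the other side. -/
def jump (β₁ β₂ β₃ : R × C × S → R × C × S) (x y : R × C × S → ℚ) (t : R × C × S) : ℚ × ℚ × ℚ :=
  (x t - y (β₁ t), x t - y (β₂ t), x t - y (β₃ t))

/-- The standard inner product on triples of rationals. -/
def dot (a b : ℚ × ℚ × ℚ) : ℚ := a.1 * b.1 + a.2.1 * b.2.1 + a.2.2 * b.2.2

theorem dot_add (a b c : ℚ × ℚ × ℚ) : dot a (b + c) = dot a b + dot a c := by
  simp only [dot, Prod.fst_add, Prod.snd_add]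
  ring

theorem dot_self_nonneg (a : ℚ × ℚ × ℚ) : 0 ≤ dot a a := by
  exact add_nonneg (add_nonneg (mul_self_nonneg _) (mul_self_nonneg _)) (mul_self_nonneg _)

theorem eq_zero_of_dot_self {a : ℚ × ℚ × ℚ} (h : dot a a = 0) : a = 0 := by
  obtain ⟨a, b, c⟩ := a
  simp only [dot] at h
  have ha : a = 0 := by nlinarith [mul_self_nonneg a, mul_self_nonneg b, mul_self_nonneg c]
  have hb : b = 0 := by nlinarith [mul_self_nonneg a, mul_self_nonneg b, mul_self_nonneg c]
  have hc : c = 0 := by nlinarith [mul_self_nonneg a, mul_self_nonneg b, mul_self_nonneg c]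
  rw [ha, hb, hc]
  rfl

/-- The maps `β₁`, `β₂`, `β₃` from white to black faces cross the edge opposite to the
symbol, the row and the column, respectively, and can be used to reindex sums. -/
structure IsCrossing (W B : Finset (R × C × S)) (β₁ β₂ β₃ : R × C × S → R × C × S) : Prop where
  row_col : ∀ t ∈ W, β₁ t ∈ B ∧ ((β₁ t).1, (β₁ t).2.1) = (t.1, t.2.1)
  col_sym : ∀ t ∈ W, β₂ t ∈ B ∧ (β₂ t).2 = t.2
  row_sym : ∀ t ∈ W, β₃ t ∈ B ∧ ((β₃ t).1, (β₃ t).2.2) = (t.1, t.2.2)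
  sum_row_col : ∀ F : R × C × S → ℚ, ∑ t ∈ W, F (β₁ t) = ∑ t ∈ B, F t
  sum_col_sym : ∀ F : R × C × S → ℚ, ∑ t ∈ W, F (β₂ t) = ∑ t ∈ B, F t
  sum_row_sym : ∀ F : R × C × S → ℚ, ∑ t ∈ W, F (β₃ t) = ∑ t ∈ B, F t

theorem IsBitrade.exists_isCrossing (h : IsBitrade W B) :
    ∃ β₁ β₂ β₃, IsCrossing W B β₁ β₂ β₃ := by
  obtain ⟨β₁, h₁, hs₁⟩ := h.exists_transfer_row_col
  obtain ⟨β₂, h₂, hs₂⟩ := h.exists_transfer_col_sym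
  obtain ⟨β₃, h₃, hs₃⟩ := h.exists_transfer_row_sym
  exact ⟨β₁, β₂, β₃, h₁, h₂, h₃, hs₁, hs₂, hs₃⟩

namespace IsCrossing

variable {β₁ β₂ β₃ : R × C × S → R × C × S}

theorem apply_row_col (hβ : IsCrossing W B β₁ β₂ β₃) (hB : IsPLS B) {r : R} {c : C} {s s' : S}
    (hw : (r, c, s) ∈ W) (hb : (r, c, s') ∈ B) : β₁ (r, c, s) = (r, c, s') := by
  obtain ⟨h1, h2⟩ := hβ.row_col _ hw
  generalize β₁ (r, c, s) = u at h1 h2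
  obtain ⟨a, b, d⟩ := u
  simp only [Prod.mk.injEq] at h2
  obtain ⟨rfl, rfl⟩ := h2
  rw [hB.cell _ _ _ _ h1 hb]

theorem apply_col_sym (hβ : IsCrossing W B β₁ β₂ β₃) (hB : IsPLS B) {r r' : R} {c : C} {s : S}
    (hw : (r, c, s) ∈ W) (hb : (r', c, s) ∈ B) : β₂ (r, c, s) = (r', c, s) := by
  obtain ⟨h1, h2⟩ := hβ.col_sym _ hw
  generalize β₂ (r, c, s) = u at h1 h2
  obtain ⟨a, b, d⟩ := u
  simp only [Prod.mk.injEq] at h2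
  obtain ⟨rfl, rfl⟩ := h2
  rw [hB.col _ _ _ _ h1 hb]

theorem apply_row_sym (hβ : IsCrossing W B β₁ β₂ β₃) (hB : IsPLS B) {r : R} {c c' : C} {s : S}
    (hw : (r, c, s) ∈ W) (hb : (r, c', s) ∈ B) : β₃ (r, c, s) = (r, c', s) := by
  obtain ⟨h1, h2⟩ := hβ.row_sym _ hw
  generalize β₃ (r, c, s) = u at h1 h2
  obtain ⟨a, b, d⟩ := u
  simp only [Prod.mk.injEq] at h2
  obtain ⟨rfl, rfl⟩ := h2
  rw [hB.row _ _ _ _ h1 hb]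

/-- Jumps of face functions are orthogonal to coboundaries of vertex functions. -/
theorem sum_dot_jump (hβ : IsCrossing W B β₁ β₂ β₃) (x y : R × C × S → ℚ) (g : R ⊕ C ⊕ S → ℚ) :
    ∑ t ∈ W, dot (coboundary g t) (jump β₁ β₂ β₃ x y t) = 0 := by
  have h1 := hβ.sum_row_col fun t => (coboundary g t).1 * y t
  have h2 := hβ.sum_col_sym fun t => (coboundary g t).2.1 * y t
  have h3 := hβ.sum_row_sym fun t => (coboundary g t).2.2 * y t
  -- The coboundary sums to zero around each black triangle. The same fact for white triangles
  -- removes the `x` terms in the final `ring`.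
  have hy : ∑ t ∈ B, (coboundary g t).1 * y t + ∑ t ∈ B, (coboundary g t).2.1 * y t +
      ∑ t ∈ B, (coboundary g t).2.2 * y t = 0 := by
    rw [← Finset.sum_add_distrib, ← Finset.sum_add_distrib]
    exact Finset.sum_eq_zero fun t _ => by simp only [coboundary]; ring
  rw [← h1, ← h2, ← h3, ← Finset.sum_add_distrib, ← Finset.sum_add_distrib] at hy
  rw [← neg_eq_zero, ← Finset.sum_neg_distrib, ← hy]
  refine Finset.sum_congr rfl fun t ht => ?_
  have e1 := Prod.mk.inj (hβ.row_col t ht).2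
  have e2 := (hβ.col_sym t ht).2
  have e3 := Prod.mk.inj (hβ.row_sym t ht).2
  simp only [coboundary, jump, dot, e1.1, e1.2, e2, e3.1, e3.2]
  ring

/-- If a coboundary is orthogonal to its sum with a jump, then it vanishes. -/
theorem coboundary_eq_zero (hβ : IsCrossing W B β₁ β₂ β₃) {x y : R × C × S → ℚ}
    {g : R ⊕ C ⊕ S → ℚ}
    (h : ∑ t ∈ W, dot (coboundary g t) (jump β₁ β₂ β₃ x y t + coboundary g t) = 0) :
    ∀ t ∈ W, coboundary g t = 0 := by
  simp only [dot_add, Finset.sum_add_distrib, hβ.sum_dot_jump, zero_add] at h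
  intro t ht
  exact eq_zero_of_dot_self
    ((Finset.sum_eq_zero_iff_of_nonneg fun t _ => dot_self_nonneg _).1 h t ht)

theorem agreeOnEdges (hβ : IsCrossing W B β₁ β₂ β₃) (hB : IsPLS B) {x y : R × C × S → ℚ}
    (h : ∀ t ∈ W, jump β₁ β₂ β₃ x y t = 0) : AgreeOnEdges W B x y := by
  refine ⟨fun r c s s' hw hb => ?_, fun r r' c s hw hb => ?_, fun r c c' s hw hb => ?_⟩
  · have := congrArg Prod.fst (h _ hw)
    simp only [jump, hβ.apply_row_col hB hw hb, Prod.fst_zero] at this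
    exact sub_eq_zero.1 this
  · have := congrArg (fun q => q.2.1) (h _ hw)
    simp only [jump, hβ.apply_col_sym hB hw hb, Prod.fst_zero, Prod.snd_zero] at this
    exact sub_eq_zero.1 this
  · have := congrArg (fun q => q.2.2) (h _ hw)
    simp only [jump, hβ.apply_row_sym hB hw hb, Prod.snd_zero] at this
    exact sub_eq_zero.1 this

end IsCrossing

theorem coboundary_eq_zero_iff {g : R ⊕ C ⊕ S → ℚ} {t : R × C × S} :
    coboundary g t = 0 ↔
      g (.inr (.inl t.2.1)) = g (.inl t.1) ∧ g (.inr (.inr t.2.2)) = g (.inl t.1) := by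
  simp only [coboundary, Prod.mk_eq_zero, sub_eq_zero]
  exact ⟨fun h => ⟨h.1, h.2.2.symm⟩, fun h => ⟨h.1, h.2.trans h.1.symm, h.2.symm⟩⟩

/-- A vertex function with zero coboundary induces a face function agreeing across all edges. -/
theorem IsBitrade.agreeOnEdges_of_coboundary_eq_zero (h : IsBitrade W B) {g : R ⊕ C ⊕ S → ℚ}
    (hg : ∀ t ∈ W, coboundary g t = 0) :
    AgreeOnEdges W B (fun t => g (.inl t.1)) fun t => g (.inl t.1) := by
  refine ⟨fun r c s s' hw hb => rfl, fun r r' c s hw hb => ?_, fun r c c' s hw hb => rfl⟩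
  obtain ⟨s', hs'⟩ := h.symm.exists_row_col hb
  exact (coboundary_eq_zero_iff.1 (hg _ hw)).1.symm.trans (coboundary_eq_zero_iff.1 (hg _ hs')).1

end Homology

/-! ### Vanishing homology and the main argument -/

section Planar

variable [DecidableEq R] [DecidableEq C] [DecidableEq S]

/-- The linear map sending a face function and a vertex function to the sum of the jump and the
coboundary, together with one value of each. -/
def jumpCoboundary (W B : Finset (R × C × S)) (β₁ β₂ β₃ : R × C × S → R × C × S)
    (t₀ : R × C × S) :
    ((W → ℚ) × (B → ℚ) × (vertices W → ℚ)) →ₗ[ℚ] ((W → ℚ × ℚ × ℚ) × ℚ × ℚ) where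
  toFun f := (fun t => jump β₁ β₂ β₃ (extendZero W f.1) (extendZero B f.2.1) t +
      coboundary (extendZero (vertices W) f.2.2) t,
    -- These two values fix the additive constants, which are otherwise the whole kernel when the
    -- bitrade is connected.
    extendZero W f.1 t₀, extendZero (vertices W) f.2.2 (.inl t₀.1))
  map_add' f f' := by
    simp only [Prod.fst_add, Prod.snd_add, map_add, jump, coboundary, Pi.add_apply, Prod.mk_add_mk,
      Prod.mk.injEq, and_true]
    funext t
    simp only [Pi.add_apply, Prod.mk_add_mk, Prod.mk.injEq]
    refine ⟨?_, ?_, ?_⟩ <;> ring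
  map_smul' q f := by
    simp only [Prod.smul_fst, Prod.smul_snd, map_smul, jump, coboundary, Pi.smul_apply,
      Prod.mk_add_mk, Prod.smul_mk, Prod.mk.injEq, and_true, smul_eq_mul, RingHom.id_apply]
    funext t
    simp only [Pi.smul_apply, Prod.smul_mk, Prod.mk.injEq, smul_eq_mul]
    refine ⟨?_, ?_, ?_⟩ <;> ring

/-- If jump and coboundary cancel, orthogonality makes both vanish. By connectedness the face and
vertex functions are then constant, with constant 0 by the normalisation at `t₀`. -/
theorem jumpCoboundary_injective {β₁ β₂ β₃ : R × C × S → R × C × S}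
    (hWB : IsBitrade W B) (hconn : IsConnected W B) (hβ : IsCrossing W B β₁ β₂ β₃)
    {t₀ : R × C × S} (ht₀ : t₀ ∈ W) :
    Function.Injective (jumpCoboundary W B β₁ β₂ β₃ t₀) := by
  rw [← LinearMap.ker_eq_bot, LinearMap.ker_eq_bot']
  rintro ⟨f, f', g⟩ hf
  simp only [jumpCoboundary, LinearMap.coe_mk, AddHom.coe_mk, Prod.mk_eq_zero] at hf
  obtain ⟨hsum, hx0, hg0⟩ := hf
  have hsum' : ∀ t ∈ W, jump β₁ β₂ β₃ (extendZero W f) (extendZero B f') t +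
      coboundary (extendZero (vertices W) g) t = 0 := fun t ht => congrFun hsum ⟨t, ht⟩
  have hδ := hβ.coboundary_eq_zero (x := extendZero W f) (y := extendZero B f')
    (g := extendZero (vertices W) g)
    (Finset.sum_eq_zero fun t ht => by rw [hsum' t ht]; simp [dot])
  have hagree := hβ.agreeOnEdges hWB.right_pls fun t ht => by
    have := hsum' t ht
    rwa [hδ t ht, add_zero] at this
  have hx : ∀ t ∈ W, extendZero W f t = 0 := fun t ht =>
    (hagree.eq_of_isConnected hWB hconn ht ht₀).trans hx0
  have hg : ∀ t ∈ W, extendZero (vertices W) g (.inl t.1) = 0 := fun t ht =>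
    ((hWB.agreeOnEdges_of_coboundary_eq_zero hδ).eq_of_isConnected hWB hconn ht ht₀).trans hg0
  refine Prod.ext (funext fun t => ?_) (Prod.ext (funext fun t => ?_) (funext fun v => ?_))
  · exact (extendZero_apply f t).symm.trans (hx t t.2)
  · obtain ⟨⟨r, c, s⟩, ht⟩ := t
    obtain ⟨s', hs'⟩ := hWB.symm.exists_row_col ht
    change f' _ = 0
    rw [← extendZero_apply f', ← hagree.row_col _ _ _ _ hs' ht, hx _ hs']
  · obtain ⟨v, hv⟩ := v
    refine (extendZero_apply g ⟨v, hv⟩).symm.trans ?_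
    obtain ⟨t, ht, hvt⟩ := Finset.mem_biUnion.1 hv
    have := coboundary_eq_zero_iff.1 (hδ t ht)
    have h0 := hg t ht
    simp only [Finset.mem_insert, Finset.mem_singleton] at hvt
    rcases hvt with rfl | rfl | rfl
    · exact h0
    · exact this.1.trans h0
    · exact this.2.trans h0

/-- This is where genus zero is used: source and target both have dimension `3|W| + 2`, so
injectivity suffices. -/
theorem IsPlanar.jumpCoboundary_surjective (h : IsPlanar W B) {β₁ β₂ β₃ : R × C × S → R × C × S}
    (hβ : IsCrossing W B β₁ β₂ β₃) {t₀ : R × C × S} (ht₀ : t₀ ∈ W) :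
    Function.Surjective (jumpCoboundary W B β₁ β₂ β₃ t₀) := by
  refine (LinearMap.injective_iff_surjective_of_finrank_eq_finrank ?_).1
    (jumpCoboundary_injective h.bitrade h.connected hβ ht₀)
  simp only [Module.finrank_prod, Module.finrank_pi, Module.finrank_pi_fintype, Fintype.card_coe,
    Module.finrank_self, Finset.sum_const, Finset.card_univ, smul_eq_mul]
  rw [h.card_vertices, ← h.bitrade.card_eq]
  ring

/-- In a planar bitrade, a triangle of the underlying graph is the boundary of a face function. -/
theorem IsPlanar.exists_potential (h : IsPlanar W B) {r₀ : R} {c₀ : C} {s₀ : S}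
    (hrc : ∃ s, (r₀, c₀, s) ∈ W) (hcs : ∃ r, (r, c₀, s₀) ∈ W) (hrs : ∃ c, (r₀, c, s₀) ∈ W) :
    ∃ x y : R × C × S → ℚ,
      (∀ r c s s', (r, c, s) ∈ W → (r, c, s') ∈ B →
        x (r, c, s) - y (r, c, s') = if r = r₀ ∧ c = c₀ then 1 else 0) ∧
      (∀ r r' c s, (r, c, s) ∈ W → (r', c, s) ∈ B →
        x (r, c, s) - y (r', c, s) = if c = c₀ ∧ s = s₀ then 1 else 0) ∧
      (∀ r c c' s, (r, c, s) ∈ W → (r, c', s) ∈ B →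
        x (r, c, s) - y (r, c', s) = if r = r₀ ∧ s = s₀ then 1 else 0) := by
  obtain ⟨s₁, hs₁⟩ := hrc
  obtain ⟨r₁, hr₁⟩ := hcs
  obtain ⟨c₁, hc₁⟩ := hrs
  obtain ⟨β₁, β₂, β₃, hβ⟩ := h.bitrade.exists_isCrossing
  -- The indicator of the edges of the triangle, oriented row to column to symbol to row.
  let e : R × C × S → ℚ × ℚ × ℚ := fun t =>
    (if t.1 = r₀ ∧ t.2.1 = c₀ then 1 else 0, if t.2.1 = c₀ ∧ t.2.2 = s₀ then 1 else 0,
      if t.1 = r₀ ∧ t.2.2 = s₀ then 1 else 0)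
  obtain ⟨⟨f, f', g⟩, hf⟩ := h.jumpCoboundary_surjective hβ hs₁ (fun t => e t, 0, 0)
  have hsum : ∀ t ∈ W, jump β₁ β₂ β₃ (extendZero W f) (extendZero B f') t +
      coboundary (extendZero (vertices W) g) t = e t :=
    fun t ht => congrFun (congrArg Prod.fst hf) ⟨t, ht⟩
  have hδ := hβ.coboundary_eq_zero (x := extendZero W f) (y := extendZero B f')
    (g := extendZero (vertices W) g) (by
      -- A coboundary sums to zero along the closed triangle, so `e` is orthogonal to it. Hence the
      -- coboundary part of `e` vanishes and `e` is a pure jump.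
      rw [Finset.sum_congr rfl fun t ht => by rw [hsum t ht]]
      generalize extendZero (vertices W) g = G
      simp only [dot, e, Finset.sum_add_distrib]
      rw [Finset.sum_eq_single_of_mem _ hs₁, Finset.sum_eq_single_of_mem _ hr₁,
        Finset.sum_eq_single_of_mem _ hc₁]
      · simp [coboundary]
      · rintro ⟨r, c, s⟩ ht hne
        rw [if_neg, mul_zero]
        rintro ⟨rfl, rfl⟩
        exact hne (by rw [h.bitrade.left_pls.row _ _ _ _ ht hc₁])
      · rintro ⟨r, c, s⟩ ht hne
        rw [if_neg, mul_zero]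
        rintro ⟨rfl, rfl⟩
        exact hne (by rw [h.bitrade.left_pls.col _ _ _ _ ht hr₁])
      · rintro ⟨r, c, s⟩ ht hne
        rw [if_neg, mul_zero]
        rintro ⟨rfl, rfl⟩
        exact hne (by rw [h.bitrade.left_pls.cell _ _ _ _ ht hs₁]))
  have hjump : ∀ t ∈ W, jump β₁ β₂ β₃ (extendZero W f) (extendZero B f') t = e t := by
    intro t ht
    rw [← hsum t ht, hδ t ht, add_zero]
  have hB := h.bitrade.right_pls
  refine ⟨extendZero W f, extendZero B f', fun r c s s' hw hb => ?_, fun r r' c s hw hb => ?_,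
    fun r c c' s hw hb => ?_⟩
  · have := congrArg Prod.fst (hjump _ hw)
    rwa [jump, hβ.apply_row_col hB hw hb] at this
  · have := congrArg (fun q => q.2.1) (hjump _ hw)
    simpa only [jump, hβ.apply_col_sym hB hw hb] using this
  · have := congrArg (fun q => q.2.2) (hjump _ hw)
    simpa only [jump, hβ.apply_row_sym hB hw hb] using this

/-- If `(W, B)` is planar and `(W, B')` is another bitrade, then some function on `W` agrees across
the edges of `(W, B')` without being constant around every row. -/
theorem IsPlanar.exists_agreeOnEdges (h : IsPlanar W B) {B' : Finset (R × C × S)}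
    (h' : IsBitrade W B') (hne : B' ≠ B) :
    ∃ x z : R × C × S → ℚ, AgreeOnEdges W B' x z ∧
      ∃ r c c' s s', (r, c, s) ∈ W ∧ (r, c', s') ∈ W ∧ x (r, c, s) ≠ x (r, c', s') := by
  -- Both mates have as many triples as `W`, so `B' ⊆ B` would give equality.
  obtain ⟨⟨r₀, c₀, s₀⟩, hT, hTB⟩ : ∃ T ∈ B', T ∉ B := by
    by_contra! hsub
    exact hne (Finset.eq_of_subset_of_card_le hsub (by rw [← h'.card_eq, h.bitrade.card_eq]))
  obtain ⟨s₂, hs₂⟩ := h'.symm.exists_row_col hT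
  obtain ⟨x, y, hrc, hcs, hrs⟩ := h.exists_potential ⟨s₂, hs₂⟩ (h'.symm.exists_col_sym hT)
    (h'.symm.exists_row_sym hT)
  have hW := h.bitrade.left_pls
  have hrow : ∀ r c c' s s', r ≠ r₀ → (r, c, s) ∈ W → (r, c', s') ∈ W →
      x (r, c, s) = x (r, c', s') := by
    intro r c c' s s' hr hw hw'
    refine eq_of_rowSeparated (y := y) hW (h.separated _ _ _ hw).1 (fun c s s' hw hb => ?_)
      (fun c c' s hw hb => ?_) (fun c s hb => h.bitrade.symm.exists_row_sym hb) hw hw'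
    · have := hrc _ _ _ _ hw hb
      rw [if_neg (fun h => hr h.1)] at this
      exact sub_eq_zero.1 this
    · have := hrs _ _ _ _ hw hb
      rw [if_neg (fun h => hr h.1)] at this
      exact sub_eq_zero.1 this
  have hcol : ∀ r r' c s s', c ≠ c₀ → (r, c, s) ∈ W → (r', c, s') ∈ W →
      x (r, c, s) = x (r', c, s') := by
    intro r r' c s s' hc hw hw'
    refine eq_of_colSeparated (y := y) hW (h.separated _ _ _ hw).2.1 (fun r s s' hw hb => ?_)
      (fun r r' s hw hb => ?_) (fun r s hb => h.bitrade.symm.exists_col_sym hb) hw hw'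
    · have := hrc _ _ _ _ hw hb
      rw [if_neg (fun h => hc h.2)] at this
      exact sub_eq_zero.1 this
    · have := hcs _ _ _ _ hw hb
      rw [if_neg (fun h => hc h.1)] at this
      exact sub_eq_zero.1 this
  have hsym : ∀ r r' c c' s, s ≠ s₀ → (r, c, s) ∈ W → (r', c', s) ∈ W →
      x (r, c, s) = x (r', c', s) := by
    intro r r' c c' s hs hw hw'
    refine eq_of_symSeparated (y := y) hW (h.separated _ _ _ hw).2.2 (fun r r' c hw hb => ?_)
      (fun r c c' hw hb => ?_) (fun r c hb => h.bitrade.symm.exists_row_sym hb) hw hw'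
    · have := hcs _ _ _ _ hw hb
      rw [if_neg (fun h => hs h.2)] at this
      exact sub_eq_zero.1 this
    · have := hrs _ _ _ _ hw hb
      rw [if_neg (fun h => hs h.2)] at this
      exact sub_eq_zero.1 this
  obtain ⟨γ₁, γ₂, γ₃, hγ⟩ := h'.symm.exists_isCrossing
  have hB' := h'.right_pls
  -- Away from the given triangle, the three white neighbours of a triple of `B'` have the same value.
  have hoff : ∀ t ∈ B', t ≠ (r₀, c₀, s₀) → x (γ₁ t) = x (γ₂ t) ∧ x (γ₁ t) = x (γ₃ t) := by
    rintro ⟨r, c, s⟩ ht htne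
    obtain ⟨s₁, h1⟩ := h'.symm.exists_row_col ht
    obtain ⟨r₁, h2⟩ := h'.symm.exists_col_sym ht
    obtain ⟨c₁, h3⟩ := h'.symm.exists_row_sym ht
    rw [hγ.apply_row_col hW ht h1, hγ.apply_col_sym hW ht h2, hγ.apply_row_sym hW ht h3]
    by_cases hr : r = r₀
    · subst hr
      have hc : c ≠ c₀ := by
        rintro rfl
        exact htne (by rw [hB'.cell _ _ _ _ ht hT])
      have hs : s ≠ s₀ := by
        rintro rfl
        exact htne (by rw [hB'.row _ _ _ _ ht hT])
      have e1 := hcol _ _ _ _ _ hc h1 h2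
      exact ⟨e1, e1.trans (hsym _ _ _ _ _ hs h2 h3)⟩
    · have e1 := hrow _ _ _ _ _ hr h1 h3
      refine ⟨?_, e1⟩
      by_cases hc : c = c₀
      · have hs : s ≠ s₀ := by
          rintro rfl
          subst hc
          exact htne (by rw [hB'.col _ _ _ _ ht hT])
        exact e1.trans (hsym _ _ _ _ _ hs h3 h2)
      · exact hcol _ _ _ _ _ hc h1 h2
  have hall : ∀ t ∈ B', x (γ₁ t) = x (γ₂ t) ∧ x (γ₁ t) = x (γ₃ t) := by
    intro t ht
    by_cases htne : t = (r₀, c₀, s₀)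
    · subst htne
      -- Each `γᵢ` carries `B'` bijectively to `W`, so the sums of `x ∘ γᵢ` over `B'` coincide. All
      -- terms but the one at the triangle are already equal, hence that one is too.
      have key : ∀ γ : R × C × S → R × C × S, ∑ u ∈ B', x (γ₁ u) = ∑ u ∈ B', x (γ u) →
          (∀ u ∈ B', u ≠ (r₀, c₀, s₀) → x (γ₁ u) = x (γ u)) →
          x (γ₁ (r₀, c₀, s₀)) = x (γ (r₀, c₀, s₀)) := by
        intro γ hsum heq
        rw [← Finset.add_sum_erase _ _ hT, ← Finset.add_sum_erase B' (fun u => x (γ u)) hT,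
          Finset.sum_congr rfl fun u hu =>
            heq u (Finset.mem_of_mem_erase hu) (Finset.ne_of_mem_erase hu)] at hsum
        exact add_right_cancel hsum
      exact ⟨key γ₂ ((hγ.sum_row_col x).trans (hγ.sum_col_sym x).symm) fun u hu hn =>
          (hoff u hu hn).1,
        key γ₃ ((hγ.sum_row_col x).trans (hγ.sum_row_sym x).symm) fun u hu hn => (hoff u hu hn).2⟩
    · exact hoff t ht htne
  refine ⟨x, fun t => x (γ₁ t), ⟨fun r c s s' hw hb => ?_, fun r r' c s hw hb => ?_,
    fun r c c' s hw hb => ?_⟩, ?_⟩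
  · exact congrArg x (hγ.apply_row_col hW hb hw).symm
  · exact (congrArg x (hγ.apply_col_sym hW hb hw).symm).trans (hall _ hb).1.symm
  · exact (congrArg x (hγ.apply_row_sym hW hb hw).symm).trans (hall _ hb).2.symm
  -- Walk around `r₀` in `(W, B)`: crossing the edge `r₀c₀` changes the value by 1. Leaving the
  -- black face by the edge `r₀s₁` changes nothing, as `s₁ ≠ s₀`.
  · obtain ⟨s₁, hs₁⟩ := h.bitrade.exists_row_col hs₂
    obtain ⟨c₁, hc₁⟩ := h.bitrade.symm.exists_row_sym hs₁
    have hs : s₁ ≠ s₀ := by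
      rintro rfl
      exact hTB hs₁
    have e1 := hrc _ _ _ _ hs₂ hs₁
    have e2 := hrs _ _ _ _ hc₁ hs₁
    rw [if_pos ⟨rfl, rfl⟩] at e1
    rw [if_neg (fun h => hs h.2)] at e2
    exact ⟨r₀, c₀, c₁, s₂, s₁, hs₂, hc₁, fun he => by linarith⟩

theorem IsPlanar.not_isConnected_and_not_isSeparated (h : IsPlanar W B) {B' : Finset (R × C × S)}
    (h' : IsBitrade W B') (hne : B' ≠ B) : ¬ IsConnected W B' ∧ ¬ IsSeparated W B' := by
  obtain ⟨x, z, hxz, r, c, c', s, s', hw, hw', hx⟩ := h.exists_agreeOnEdges h' hne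
  refine ⟨fun hconn => hx (hxz.eq_of_isConnected h' hconn hw hw'), fun hsep => hx ?_⟩
  exact eq_of_rowSeparated (y := z) h'.left_pls (hsep _ _ _ hw).1 (hxz.row_col r)
    (hxz.row_sym r) (fun c s hb => h'.symm.exists_row_sym hb) hw hw'

end Planar

end LatinBitrade

theorem lemmal {R C S : Type*} [DecidableEq R] [DecidableEq C] [DecidableEq S] :
    (∀ W B B' : Finset (R × C × S),
      LatinBitrade.IsPlanar W B → LatinBitrade.IsBitrade W B' → B' ≠ B →
        ¬ LatinBitrade.IsConnected W B' ∧ ¬ LatinBitrade.IsSeparated W B') ∧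
    (∀ W : Finset (R × C × S), LatinBitrade.IsSphericalTrade W →
      ∃! B : Finset (R × C × S),
        LatinBitrade.IsBitrade W B ∧ LatinBitrade.IsConnected W B ∧
          LatinBitrade.IsSeparated W B) := by
  refine ⟨fun W B B' h h' hne => h.not_isConnected_and_not_isSeparated h' hne, ?_⟩
  rintro W ⟨B, h⟩
  refine ⟨B, ⟨h.bitrade, h.connected, h.separated⟩, ?_⟩
  rintro B' ⟨h', hconn, -⟩
  by_contra hne
  exact (h.not_isConnected_and_not_isSeparated h' hne).1 hconn
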